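/- Let $p$ be a prime and $n\ge 1$ an integer. Let $W=W(\mathbb F_{p^n})$ be the ring of $p$-typical Witt vectors, with Frobenius lift $\varphi$, and let $$\mathcal O_n = W\langle S \mid S^n=p,\ Sw=w^{\varphi}S \text{ for all } w\in W\rangle ,$$ with its $p$-adic topology. Let $\mathbb S_n=\mathcal O_n^\times$ be the Morava stabilizer group of height $n$, a topological group, and let $\mathbb S_n^{\mathrm{ab}}=\mathbb S_n/\overline{[\mathbb S_n,\mathbb S_n]}$ be its (continuous) abelianization. Then there are isomorphisms of topological groups $$\mathbb S_n^{\mathrm{ab}}\;\cong\;\mathbb Z_p^\times\oplus_{\mathbb F_p^\times}\mathbb F_{p^n}^\times\;\cong\;\begin{cases}\mathbb Z_p\times\mathbb F_{p^n}^\times, & p>2,\\ \mathbb Z_2\times\{\pm1\}\times\mathbb F_{2^n}^\times, & p=2.\end{cases}$$ This holds both when $\mathbb Z_p^\times\oplus_{\mathbb F_p^\times}\mathbb F_{p^n}^\times$ denotes the pushout of abelian groups along the Teichmüller character $\mathbb F_p^\times\to\mathbb Z_p^\times$ and the inclusion $\mathbb F_p^\times\to\mathbb F_{p^n}^\times$ (with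 the quotient topology), and when it denotes the fibre product of $\mathbb Z_p^\times$ and $\mathbb F_{p^n}^\times$ over $\mathbb F_p^\times$ along reduction modulo $p$ and the norm (with the subspace topology). Here $\mathbb F_{p^n}^\times$ is discrete. -/

import Mathlib

noncomputable section

/-- The Frobenius lift `φ` of the ring of `p`-typical Witt vectors, as an action of the additive
monoid `ℕ` by ring endomorphisms: `m` acts as `φ^m`.  This is the form in which Mathlib's skew
polynomial ring `SkewPolynomial (WittVector p k)`, with `X * w = φ w * X`, expects it. -/
instance wittFrobeniusAction (p : ℕ) [Fact p.Prime] (k : Type) [CommRing k] :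
    MulSemiringAction (Multiplicative ℕ) (WittVector p k) where
  smul m w := (WittVector.frobenius : WittVector p k →+* WittVector p k)^[m.toAdd] w
  one_smul _ := rfl
  mul_smul a b w := Function.iterate_add_apply _ a.toAdd b.toAdd w
  smul_zero m := iterate_map_zero _ m.toAdd
  smul_add m := iterate_map_add _ m.toAdd
  smul_one m := iterate_map_one _ m.toAdd
  smul_mul m := iterate_map_mul _ m.toAdd

/-- The relation `S ^ n = p` on the skew polynomial ring `W(k)[S; φ]`. -/
inductive MoravaRel (p : ℕ) [Fact p.Prime] (n : ℕ) (k : Type) [CommRing k] :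
    SkewPolynomial (WittVector p k) → SkewPolynomial (WittVector p k) → Prop
  | S_pow : MoravaRel p n k (SkewPolynomial.X ^ n) (p : SkewPolynomial (WittVector p k))

/-- The order `W(k)⟨S ∣ S ^ n = p, S w = φ(w) S for w ∈ W(k)⟩`: the quotient of the skew
polynomial ring `W(k)[S; φ]`, in which `S w = φ(w) S`, by the relation `S ^ n = p`.
For `k` the field with `p ^ n` elements this is the order `O_n`. -/
def MoravaOrder (p : ℕ) [Fact p.Prime] (n : ℕ) (k : Type) [CommRing k] : Type :=
  RingQuot (MoravaRel p n k)

instance (p : ℕ) [Fact p.Prime] (n : ℕ) (k : Type) [CommRing k] : Ring (MoravaOrder p n k) :=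
  inferInstanceAs (Ring (RingQuot (MoravaRel p n k)))

/-- The subgroups `p ^ i A` of a ring `A` are a basis of neighbourhoods of `0` for a ring
topology. -/
theorem padic_ringSubgroupsBasis (p : ℕ) (A : Type) [Ring A] :
    RingSubgroupsBasis fun i : ℕ => (AddMonoidHom.mulLeft ((p : A) ^ i)).range := by
  have hc : ∀ (i : ℕ) (x : A), x * (p : A) ^ i = (p : A) ^ i * x := fun i x =>
    ((Nat.cast_commute p x).pow_left i).eq.symm
  refine ⟨fun i j => ⟨i + j, ?_⟩, fun i => ⟨i, ?_⟩, fun x i => ⟨i, ?_⟩, fun x i => ⟨i, ?_⟩⟩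
  · rintro _ ⟨y, rfl⟩
    refine ⟨⟨(p : A) ^ j * y, ?_⟩, ⟨(p : A) ^ i * y, ?_⟩⟩
    · simp [pow_add, mul_assoc]
    · simp [add_comm i j, pow_add, mul_assoc]
  · rintro _ ⟨_, ⟨y, rfl⟩, _, ⟨z, rfl⟩, rfl⟩
    exact ⟨y * ((p : A) ^ i * z), by simp [mul_assoc]⟩
  · rintro _ ⟨y, rfl⟩
    exact ⟨x * y, by simp [← mul_assoc, hc]⟩
  · rintro _ ⟨y, rfl⟩
    exact ⟨y * x, by simp [mul_assoc]⟩

/-- The `p`-adic topology on the order `O_n`; the group `O_n^×` of units then has the topology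
of the units of a topological ring. -/
instance (p : ℕ) [Fact p.Prime] (n : ℕ) (k : Type) [CommRing k] :
    TopologicalSpace (MoravaOrder p n k) :=
  (padic_ringSubgroupsBasis p (MoravaOrder p n k)).topology

instance (p : ℕ) [Fact p.Prime] (n : ℕ) (k : Type) [CommRing k] :
    IsTopologicalRing (MoravaOrder p n k) :=
  (padic_ringSubgroupsBasis p (MoravaOrder p n k)).toRingFilterBasis.isTopologicalRing

/-- The finite field with `p ^ n` elements is discrete. -/
instance (p : ℕ) [Fact p.Prime] (n : ℕ) : TopologicalSpace (GaloisField p n) := ⊥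

instance (p : ℕ) [Fact p.Prime] (n : ℕ) : DiscreteTopology (GaloisField p n) := ⟨rfl⟩

/-- The (special) Morava stabilizer group `S_n = O_n^×` at the prime `p` and height `n`. -/
abbrev MoravaStabilizer (p : ℕ) [Fact p.Prime] (n : ℕ) : Type :=
  (MoravaOrder p n (GaloisField p n))ˣ

/-- The Teichmüller character `F_p^× → ℤ_p^×`. -/
def teichmullerUnits (p : ℕ) [Fact p.Prime] : (ZMod p)ˣ →* ℤ_[p]ˣ :=
  Units.map (((WittVector.equiv p : WittVector p (ZMod p) →+* ℤ_[p]) :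
    WittVector p (ZMod p) →* ℤ_[p]).comp (WittVector.teichmuller p))

/-- The inclusion `F_p^× → F_{p^n}^×`. -/
def primeFieldUnits (p : ℕ) [Fact p.Prime] (n : ℕ) : (ZMod p)ˣ →* (GaloisField p n)ˣ :=
  Units.map (algebraMap (ZMod p) (GaloisField p n) : ZMod p →* GaloisField p n)

/-- The amalgamated sum (pushout of abelian groups) `ℤ_p^× ⊕_{F_p^×} F_{p^n}^×` along the
Teichmüller character and the inclusion, with the quotient topology. -/
abbrev UnitsPushout (p : ℕ) [Fact p.Prime] (n : ℕ) : Type :=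
  (ℤ_[p]ˣ × (GaloisField p n)ˣ) ⧸
    ((teichmullerUnits p).prod (primeFieldUnits p n)⁻¹).range

/-- The fibre product of `ℤ_p^×` and `F_{p^n}^×` over `F_p^×`, along reduction mod `p` and the
norm, with the subspace topology. -/
abbrev unitsFibreProduct (p : ℕ) [Fact p.Prime] (n : ℕ) : Subgroup (ℤ_[p]ˣ × (GaloisField p n)ˣ) :=
  MonoidHom.eqLocus
    ((Units.map ((PadicInt.toZMod : ℤ_[p] →+* ZMod p) : ℤ_[p] →* ZMod p)).comp
      (MonoidHom.fst ℤ_[p]ˣ (GaloisField p n)ˣ))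
    ((Units.map (Algebra.norm (ZMod p) : GaloisField p n →* ZMod p)).comp
      (MonoidHom.snd ℤ_[p]ˣ (GaloisField p n)ˣ))

end

/-! The order acts on `W^n`: `S` is a cyclic shift with one entry `p`, and `w` is the diagonal of
its Frobenius conjugates. Moving `S` past a matrix of the image applies Frobenius to its entries, so
determinants are Frobenius-fixed and lie in `ℤ_p`: this is the reduced norm. Modulo `p` the matrices
are upper triangular with the conjugates of the residue on the diagonal, so reduced norm and residue
together map the units to the fibre product (`toFibreProduct`).

The rest is the filtration by `1 + O S^i`. To leading order the reduced norm of `1 + p^m z` is `1 +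
p^m Tr(z)` (`reducedNorm_one_add`), so surjectivity of the trace, successive approximation and
compactness make `toFibreProduct` surjective. An element of its kernel is approximated by
commutators layer by layer (`exists_commutator`). If `n ∤ i`, commutators of Teichmüller units with
`1 + z S^i` fill the layer. If `n ∣ i`, norm one forces the leading residue to have trace zero,
hence to be `b^p - b`, the leading term of the commutator of `1 + S` and `1 + b S^(i-1)`. So the
kernel is the closure of the commutator subgroup, and compactness makes the induced bijection a
homeomorphism.

The Teichmüller character splits `ℤ_p^×`, which identifies both the fibre product and the pushout
with principal units times `𝔽^×`. The principal units are the `(1 + p)^z` for `p > 2` and the `±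
5^z` for `p = 2`. -/

noncomputable section

open WittVector Topology

namespace MoravaOrder

/-! ### The order by generators and relations, and its matrices -/

section General

variable {p : ℕ} [Fact p.Prime] {n : ℕ} {k : Type} [CommRing k]

variable (p n k) in
/-- The quotient map from the skew polynomial ring. -/
def mk : SkewPolynomial (WittVector p k) →+* MoravaOrder p n k :=
  RingQuot.mkRingHom (MoravaRel p n k)

theorem mk_surjective : Function.Surjective (mk p n k) :=
  RingQuot.mkRingHom_surjective (MoravaRel p n k)

variable (p n k) in
/-- The inclusion `W(k) → O`. -/
def ofWitt : WittVector p k →+* MoravaOrder p n k :=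
  (mk p n k).comp SkewPolynomial.CRingHom

variable (p n k) in
/-- The element `S` of the order. -/
def unif : MoravaOrder p n k :=
  mk p n k SkewPolynomial.X

theorem unif_mul_ofWitt (w : WittVector p k) :
    unif p n k * ofWitt p n k w = ofWitt p n k (frobenius w) * unif p n k := by
  simp only [unif, ofWitt, RingHom.comp_apply]
  rw [← map_mul (mk p n k), ← map_mul (mk p n k), SkewPolynomial.CRingHom_eq_C,
    SkewPolynomial.CRingHom_eq_C, SkewPolynomial.C_mul_X_eq_monomial,
    ← SkewPolynomial.monomial_one_one_eq_X, SkewPolynomial.monomial_mul_C, one_mul]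
  rfl

theorem unif_pow : unif p n k ^ n = (p : MoravaOrder p n k) := by
  have h : mk p n k (SkewPolynomial.X ^ n) = mk p n k p := RingQuot.mkRingHom_rel MoravaRel.S_pow
  rwa [map_pow, map_natCast] at h

/-- The universal property of the order. -/
def lift {A : Type*} [Ring A] (f : WittVector p k →+* A) (s : A)
    (h : ∀ w, s * f w = f (frobenius w) * s) (hs : s ^ n = (p : A)) : MoravaOrder p n k →+* A :=
  RingQuot.lift ⟨SkewMonoidAlgebra.liftNCRingHom f (powersHom A s) (by
    intro x y
    change f (frobenius^[y.toAdd] x) * s ^ y.toAdd = s ^ y.toAdd * f x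
    generalize y.toAdd = m
    induction m generalizing x with
    | zero => simp
    | succ m ih => rw [Function.iterate_succ_apply, pow_succ, ← mul_assoc, ih, mul_assoc, ← h,
        mul_assoc]), by
    rintro _ _ ⟨⟩
    rw [map_pow, map_natCast, ← hs]
    congr 1
    change SkewMonoidAlgebra.liftNC _ _ (SkewMonoidAlgebra.single (Multiplicative.ofAdd 1) 1) = s
    simp⟩

theorem lift_ofWitt {A : Type*} [Ring A] (f : WittVector p k →+* A) (s : A)
    (h : ∀ w, s * f w = f (frobenius w) * s) (hs : s ^ n = (p : A)) (w : WittVector p k) :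
    lift f s h hs (ofWitt p n k w) = f w := by
  change RingQuot.lift _ (RingQuot.mkRingHom _ _) = _
  rw [RingQuot.lift_mkRingHom_apply]
  change SkewMonoidAlgebra.liftNC _ _ (SkewMonoidAlgebra.single 1 w) = _
  simp

theorem lift_unif {A : Type*} [Ring A] (f : WittVector p k →+* A) (s : A)
    (h : ∀ w, s * f w = f (frobenius w) * s) (hs : s ^ n = (p : A)) :
    lift f s h hs (unif p n k) = s := by
  change RingQuot.lift _ (RingQuot.mkRingHom _ _) = _
  rw [RingQuot.lift_mkRingHom_apply]
  change SkewMonoidAlgebra.liftNC _ _ (SkewMonoidAlgebra.single (Multiplicative.ofAdd 1) 1) = s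
  simp

theorem induction_on {P : MoravaOrder p n k → Prop} (x : MoravaOrder p n k)
    (hw : ∀ w, P (ofWitt p n k w)) (hadd : ∀ x y, P x → P y → P (x + y))
    (hS : ∀ x, P x → P (x * unif p n k)) : P x := by
  obtain ⟨q, rfl⟩ := mk_surjective x
  induction q using SkewPolynomial.induction with
  | h0 => simpa using hw 0
  | ha m r q _ _ ih =>
    rw [map_add]
    refine hadd _ _ ?_ ih
    rw [← SkewPolynomial.C_mul_X_pow_eq_monomial, map_mul, map_pow]
    clear * - hw hS
    induction m with
    | zero => rw [pow_zero, mul_one]; exact hw r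
    | succ m ih => rw [pow_succ, ← mul_assoc]; exact hS _ ih

variable [NeZero n]

theorem exists_eq_sum (x : MoravaOrder p n k) :
    ∃ c : Fin n → WittVector p k, x = ∑ j, ofWitt p n k (c j) * unif p n k ^ (j : ℕ) := by
  induction x using induction_on with
  | hw w =>
    refine ⟨Pi.single 0 w, ?_⟩
    rw [Finset.sum_eq_single 0]
    · simp
    · intro b _ hb
      simp [hb]
    · simp
  | hadd x y hx hy =>
    obtain ⟨c, rfl⟩ := hx
    obtain ⟨d, rfl⟩ := hy
    exact ⟨c + d, by simp [add_mul, Finset.sum_add_distrib]⟩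
  | hS x hx =>
    obtain ⟨c, rfl⟩ := hx
    obtain ⟨m, rfl⟩ := Nat.exists_eq_succ_of_ne_zero (NeZero.ne n)
    -- Right multiplication by `S` shifts the coefficients; the top one wraps around to degree `0`
    -- through `S ^ n = p`.
    refine ⟨Fin.cons (p * c (Fin.last m)) fun i => c i.castSucc, ?_⟩
    rw [Finset.sum_mul, Fin.sum_univ_castSucc, Fin.sum_univ_succ, add_comm]
    congr 1
    · simp only [Fin.val_last, mul_assoc, ← pow_succ, Fin.cons_zero]
      have h : unif p m.succ k ^ (m + 1) = p := unif_pow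
      rw [h]
      simp [Nat.cast_comm]
    · simp [mul_assoc, ← pow_succ]

variable (p n k) in
/-- The matrix of `S` in the representation of the order on `W(k) ^ n`. -/
def unifMatrix : Matrix (Fin n) (Fin n) (WittVector p k) :=
  Matrix.of fun i j => if j = i + 1 then (if j = 0 then (p : WittVector p k) else 1) else 0

variable (p n k) in
/-- The matrix of `w ∈ W(k)` in the representation of the order on `W(k) ^ n`. -/
def wittMatrix : WittVector p k →+* Matrix (Fin n) (Fin n) (WittVector p k) :=
  (Matrix.diagonalRingHom (Fin n) (WittVector p k)).comp
    (RingHom.pi fun i : Fin n => (frobenius : WittVector p k →+* WittVector p k) ^ (i : ℕ))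

omit [NeZero n] in
theorem wittMatrix_apply (w : WittVector p k) :
    wittMatrix p n k w = Matrix.diagonal fun i : Fin n => frobenius^[i] w := by
  change Matrix.diagonal _ = _
  congr 1

/-- The product collects one factor `p` for each time the `m`-step shift from `i` passes through
index `0`. -/
theorem unifMatrix_pow_apply (m : ℕ) (i j : Fin n) : (unifMatrix p n k ^ m) i j =
    if j = i + Fin.ofNat n m then ∏ l ∈ Finset.range m,
      (if i + 1 + Fin.ofNat n l = 0 then (p : WittVector p k) else 1) else 0 := by
  induction m generalizing j with
  | zero => simp [Matrix.one_apply, eq_comm]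
  | succ m ih =>
    have h1 : Fin.ofNat n (m + 1) = Fin.ofNat n m + 1 := by
      ext; simp [Fin.val_add]
    rw [pow_succ, Matrix.mul_apply, Finset.sum_eq_single (i + Fin.ofNat n m)]
    · rw [ih, if_pos rfl, Finset.prod_range_succ, unifMatrix, Matrix.of_apply, h1]
      by_cases h : j = i + Fin.ofNat n m + 1
      · rw [if_pos h, if_pos (h.trans (add_assoc _ _ _)), h, add_right_comm]
      · rw [if_neg h, if_neg (by rwa [← add_assoc]), mul_zero]
    · intro b _ hb
      rw [ih, if_neg hb, zero_mul]
    · simp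

theorem unifMatrix_pow : unifMatrix p n k ^ n = (p : Matrix (Fin n) (Fin n) (WittVector p k)) := by
  have h (i : Fin n) :
      ∏ l : Fin n, (if i + 1 + l = 0 then (p : WittVector p k) else 1) = p := by
    refine (Equiv.prod_comp (Equiv.addLeft (i + 1))
      fun l => if l = 0 then (p : WittVector p k) else 1).trans ?_
    rw [Fintype.prod_ite_eq']
  rw [← Matrix.diagonal_natCast]
  ext1 i j
  rw [unifMatrix_pow_apply, show Fin.ofNat n n = 0 by ext; simp, add_zero, Finset.prod_range]
  simp only [Fin.ofNat_val_eq_self, h, Matrix.diagonal_apply]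
  simp only [eq_comm]

end General

/-! ### The representation over the finite field -/

section Galois

variable {p : ℕ} [Fact p.Prime] {n : ℕ} [NeZero n]

local notation "𝔽" => GaloisField p n
local notation "𝕎" => WittVector p (GaloisField p n)
local notation "𝒪" => MoravaOrder p n (GaloisField p n)
local notation "ι" => ofWitt p n (GaloisField p n)
local notation "ϖ" => unif p n (GaloisField p n)

omit [NeZero n] in
theorem frobenius_iterate_coeff (m : ℕ) (w : 𝕎) (i : ℕ) :
    (frobenius^[m] w).coeff i = w.coeff i ^ p ^ m := by
  induction m generalizing w with
  | zero => simp
  | succ m ih => rw [Function.iterate_succ_apply, ih, coeff_frobenius_charP, ← pow_mul, pow_succ']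

theorem galoisField_pow (a : 𝔽) : a ^ p ^ n = a := by
  rw [← GaloisField.card p n (NeZero.ne n)]
  have := Fintype.ofFinite 𝔽
  rw [Nat.card_eq_fintype_card, FiniteField.pow_card]

theorem frobenius_iterate_eq (w : 𝕎) : frobenius^[n] w = w := by
  ext i
  rw [frobenius_iterate_coeff, galoisField_pow]

variable (p n) in
/-- The representation of the order on `W(k) ^ n`. -/
def rep : 𝒪 →+* Matrix (Fin n) (Fin n) 𝕎 :=
  lift (wittMatrix p n 𝔽) (unifMatrix p n 𝔽) (fun w => by
    ext1 i j
    rw [wittMatrix_apply, wittMatrix_apply, Matrix.mul_diagonal, Matrix.diagonal_mul, unifMatrix,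
      Matrix.of_apply]
    by_cases h : j = i + 1
    · rw [if_pos h, mul_comm]
      congr 1
      subst h
      rw [← Function.iterate_succ_apply]
      by_cases hi : i.val + 1 = n
      · rw [show ((i + 1 : Fin n) : ℕ) = 0 by simp [Fin.val_add, hi], Nat.succ_eq_add_one, hi,
          frobenius_iterate_eq]
        rfl
      · rw [show ((i + 1 : Fin n) : ℕ) = i + 1 by
          simp only [Fin.val_add, Fin.val_one', Nat.add_mod_mod]
          exact Nat.mod_eq_of_lt (by omega)]
    · rw [if_neg h, zero_mul, mul_zero]) unifMatrix_pow

theorem rep_ofWitt (w : 𝕎) : rep p n (ι w) = Matrix.diagonal fun i : Fin n => frobenius^[i] w :=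
  (lift_ofWitt ..).trans (wittMatrix_apply w)

theorem rep_unif : rep p n ϖ = unifMatrix p n 𝔽 := lift_unif ..

/-- The reason why determinants will be Frobenius-invariant. -/
theorem rep_unif_mul (x : 𝒪) :
    rep p n ϖ * rep p n x = (rep p n x).map frobenius * rep p n ϖ := by
  induction x using induction_on with
  | hw w =>
    rw [← map_mul, unif_mul_ofWitt, map_mul]
    congr 1
    simp only [rep_ofWitt, Matrix.diagonal_map (map_zero (frobenius : 𝕎 →+* 𝕎)),
      ← Function.iterate_succ_apply, ← Function.iterate_succ_apply']
  | hadd x y hx hy => rw [map_add, mul_add, hx, hy,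
      Matrix.map_add _ (map_add WittVector.frobenius), add_mul]
  | hS x hx =>
    rw [map_mul, Matrix.map_mul, ← mul_assoc, hx]
    congr 2
    rw [rep_unif]
    ext1 i j
    simp only [unifMatrix, Matrix.map_apply, Matrix.of_apply]
    split_ifs <;> simp

/-- Starting from row `0`, fewer than `n` shifts never wrap around, so no factor `p` appears. Hence
the powers `S^j`, `j < n`, are independent over `W`. -/
theorem rep_zero_sum (c : Fin n → 𝕎) (j : Fin n) :
    rep p n (∑ j : Fin n, ι (c j) * ϖ ^ (j : ℕ)) 0 j = c j := by
  rw [map_sum, Matrix.sum_apply, Finset.sum_eq_single j]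
  · rw [map_mul, map_pow, rep_ofWitt, rep_unif, Matrix.diagonal_mul, unifMatrix_pow_apply,
      if_pos (by simp), Finset.prod_eq_one]
    · simp
    · intro l hl
      rw [if_neg]
      rw [zero_add]
      intro h
      have := congrArg Fin.val h
      have hj := j.isLt
      rw [Finset.mem_range] at hl
      simp only [Fin.val_add, Fin.val_one', Fin.val_ofNat, Fin.val_zero, ← Nat.add_mod] at this
      rw [Nat.mod_eq_of_lt (by omega)] at this
      omega
  · intro b _ hb
    rw [map_mul, map_pow, rep_ofWitt, rep_unif, Matrix.diagonal_mul, unifMatrix_pow_apply, if_neg,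
      mul_zero]
    simpa using hb.symm
  · simp

/-- An element is determined by its coordinates, the first row of its matrix. -/
theorem eq_sum_coord (x : 𝒪) : x = ∑ j : Fin n, ι (rep p n x 0 j) * ϖ ^ (j : ℕ) := by
  obtain ⟨c, rfl⟩ := exists_eq_sum x
  simp only [rep_zero_sum]

/-! ### Residues and the ideal generated by `S` -/

omit [NeZero n] in
theorem exists_eq_add_mul_unif (x : 𝒪) : ∃ w y, x = ι w + y * ϖ := by
  induction x using induction_on with
  | hw w => exact ⟨w, 0, by simp⟩
  | hadd x y hx hy =>
    obtain ⟨w, y, rfl⟩ := hx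
    obtain ⟨w', y', rfl⟩ := hy
    exact ⟨w + w', y + y', by rw [map_add, add_mul]; abel⟩
  | hS x _ => exact ⟨0, x, by simp⟩

variable (p n) in
/-- The residue map `O → 𝔽`, with kernel `O * S`. -/
def residue : 𝒪 →+* 𝔽 :=
  lift constantCoeff 0 (by simp) (by simp [NeZero.ne n])

theorem residue_ofWitt (w : 𝕎) : residue p n (ι w) = w.coeff 0 := lift_ofWitt ..

theorem residue_unif : residue p n ϖ = 0 := lift_unif ..

omit [NeZero n] in
theorem exists_eq_p_mul {w : 𝕎} (h : w.coeff 0 = 0) : ∃ v, w = p * v := by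
  rwa [← dvd_def, ← Ideal.mem_span_singleton, mem_span_p_iff_coeff_zero_eq_zero]

theorem exists_eq_mul_unif {x : 𝒪} (h : residue p n x = 0) : ∃ y, x = y * ϖ := by
  obtain ⟨w, y, rfl⟩ := exists_eq_add_mul_unif x
  rw [map_add, map_mul, residue_unif, mul_zero, add_zero, residue_ofWitt] at h
  obtain ⟨v, rfl⟩ := exists_eq_p_mul h
  refine ⟨ι v * ϖ ^ (n - 1) + y, ?_⟩
  rw [add_mul, mul_assoc, ← pow_succ, Nat.sub_add_cancel (NeZero.one_le), unif_pow, map_mul,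
    map_natCast, Nat.cast_comm]

theorem exists_unif_mul (z : 𝒪) :
    ∃ z', ϖ * z = z' * ϖ ∧ residue p n z' = residue p n z ^ p := by
  induction z using induction_on with
  | hw w =>
    exact ⟨_, unif_mul_ofWitt w, by rw [residue_ofWitt, residue_ofWitt, coeff_frobenius_charP]⟩
  | hadd x y hx hy =>
    obtain ⟨x', hx, hx'⟩ := hx
    obtain ⟨y', hy, hy'⟩ := hy
    exact ⟨x' + y', by rw [mul_add, add_mul, hx, hy], by rw [map_add, map_add, hx', hy', add_pow_char]⟩
  | hS x hx =>
    obtain ⟨x', hx, -⟩ := hx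
    exact ⟨x' * ϖ, by rw [← mul_assoc, hx], by simp [residue_unif, (Fact.out : p.Prime).ne_zero]⟩

theorem exists_unif_pow_mul (i : ℕ) (z : 𝒪) :
    ∃ z', ϖ ^ i * z = z' * ϖ ^ i ∧ residue p n z' = residue p n z ^ p ^ i := by
  induction i generalizing z with
  | zero => exact ⟨z, by simp⟩
  | succ i ih =>
    obtain ⟨y, hy, hy'⟩ := exists_unif_mul z
    obtain ⟨x, hx, hx'⟩ := ih y
    exact ⟨x, by rw [pow_succ, mul_assoc, hy, ← mul_assoc, hx, mul_assoc],
      by rw [hx', hy', ← pow_mul, pow_succ']⟩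

/-- Modulo `p` the wrap-around entry of `S` vanishes, so `S` is strictly upper triangular, while `W`
acts diagonally. -/
theorem rep_coeff_zero (x : 𝒪) (i j : Fin n) (hij : j ≤ i) :
    (rep p n x i j).coeff 0 = if j = i then residue p n x ^ p ^ (i : ℕ) else 0 := by
  induction x using induction_on generalizing i j with
  | hw w =>
    rw [rep_ofWitt, Matrix.diagonal_apply, residue_ofWitt]
    simp only [eq_comm (a := i)]
    split_ifs
    · rw [frobenius_iterate_coeff]
    · simp
  | hadd x y hx hy =>
    rw [map_add, Matrix.add_apply, WittVector.add_coeff_zero, hx _ _ hij, hy _ _ hij]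
    split_ifs
    · rw [map_add, add_pow_char_pow]
    · simp
  | hS x hx =>
    rw [map_mul (residue p n), residue_unif, mul_zero,
      zero_pow (pow_ne_zero _ (Fact.out : p.Prime).ne_zero), ite_self, map_mul, Matrix.mul_apply,
      rep_unif]
    rw [← WittVector.constantCoeff_apply, map_sum]
    refine Finset.sum_eq_zero fun l _ => ?_
    rw [map_mul, unifMatrix, Matrix.of_apply]
    split_ifs with h1 h2
    · simp
    · have hl : l < i := by
        refine lt_of_lt_of_le ?_ hij
        rw [Fin.lt_def, h1, Fin.val_add, Fin.val_one', Nat.add_mod_mod, Nat.mod_eq_of_lt]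
        · exact Nat.lt_succ_self _
        · by_contra hl
          refine h2 (h1.trans (Fin.ext ?_))
          simp [Fin.val_add, show l.val + 1 = n by omega]
      rw [WittVector.constantCoeff_apply, hx _ _ hl.le, if_neg hl.ne, zero_mul]
    · simp

/-! ### The reduced norm -/

theorem det_rep_coeff_zero (x : 𝒪) :
    (rep p n x).det.coeff 0 = algebraMap (ZMod p) 𝔽 (Algebra.norm (ZMod p) (residue p n x)) := by
  rw [FiniteField.algebraMap_norm_eq_prod_pow, GaloisField.finrank p (NeZero.ne n), Nat.card_zmod,
    ← WittVector.constantCoeff_apply, RingHom.map_det, Matrix.det_of_isUpperTriangular,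
    Finset.prod_range]
  · refine Finset.prod_congr rfl fun i _ => ?_
    simp [rep_coeff_zero]
  · intro i j hij
    have hij : j < i := hij
    simp [rep_coeff_zero _ _ _ hij.le, hij.ne]

omit [NeZero n] in
theorem natCast_ne_zero : (p : 𝕎) ≠ 0 := WittVector.p_nonzero p _

/-- Take determinants in `rep_unif_mul` and cancel that of `S`, which is nonzero because its `n`-th
power is `p^n`. -/
theorem frobenius_det_rep (x : 𝒪) : frobenius (rep p n x).det = (rep p n x).det := by
  have h := congrArg Matrix.det (rep_unif_mul x)
  have hS : (rep p n ϖ).det ≠ 0 := by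
    intro h0
    have := congrArg Matrix.det (unifMatrix_pow (p := p) (n := n) (k := 𝔽))
    rw [← rep_unif, Matrix.det_pow, h0, zero_pow (NeZero.ne n), ← Matrix.diagonal_natCast,
      Matrix.det_diagonal] at this
    simp only [Finset.prod_const] at this
    exact pow_ne_zero _ natCast_ne_zero this.symm
  rw [Matrix.det_mul, Matrix.det_mul, mul_comm] at h
  rw [RingHom.map_det]
  exact (mul_right_cancel₀ hS h).symm

variable (p n) in
/-- The embedding `ℤ_p → W(𝔽)`. -/
def ofPadic : ℤ_[p] →+* 𝕎 :=
  (WittVector.map (algebraMap (ZMod p) 𝔽)).comp (WittVector.equiv p).symm.toRingHom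

omit [NeZero n] in
theorem ofPadic_injective : Function.Injective (ofPadic p n) :=
  (WittVector.map_injective _ (algebraMap (ZMod p) 𝔽).injective).comp
    (WittVector.equiv p).symm.injective

-- Every Witt coefficient satisfies `a^p = a`, so it lies in the prime field.
omit [NeZero n] in
theorem exists_ofPadic_eq {w : 𝕎} (h : frobenius w = w) : ∃ u, ofPadic p n u = w := by
  have hc (i : ℕ) : ∃ a : ZMod p, algebraMap (ZMod p) 𝔽 a = w.coeff i := by
    have := congrArg (fun v => v.coeff i) h
    simp only [coeff_frobenius_charP] at this
    rw [← Subfield.mem_bot_iff_pow_eq_self, mem_bot_iff_intCast p] at this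
    obtain ⟨m, hm⟩ := this
    exact ⟨m, by simpa using hm⟩
  choose c hc using hc
  refine ⟨WittVector.equiv p (WittVector.mk p c), ?_⟩
  ext i
  simp [ofPadic, hc, WittVector.map_coeff]

-- This identifies the zeroth Witt coefficient on `ℤ_p` with reduction modulo `p`.
omit [NeZero n] in
theorem padic_ringHom_zmod_eq (f : ℤ_[p] →+* ZMod p) : f = PadicInt.toZMod := by
  ext1 x
  obtain ⟨m, hm⟩ := ZMod.natCast_zmod_surjective (PadicInt.toZMod x)
  have h : x - (m : ℤ_[p]) ∈ Ideal.span {(p : ℤ_[p])} := by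
    rw [← PadicInt.maximalIdeal_eq_span_p, ← PadicInt.ker_toZMod, RingHom.mem_ker, map_sub,
      map_natCast, hm, sub_self]
  obtain ⟨y, hy⟩ := Ideal.mem_span_singleton.1 h
  rw [← hm, sub_eq_iff_eq_add.1 hy]
  simp

omit [NeZero n] in
theorem ofPadic_coeff_zero (u : ℤ_[p]) :
    (ofPadic p n u).coeff 0 = algebraMap (ZMod p) 𝔽 (PadicInt.toZMod u) := by
  rw [← padic_ringHom_zmod_eq (WittVector.constantCoeff.comp (WittVector.equiv p).symm.toRingHom)]
  simp [ofPadic, WittVector.map_coeff]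

theorem exists_ofPadic_eq_det (x : 𝒪) : ∃ u, ofPadic p n u = (rep p n x).det :=
  exists_ofPadic_eq (frobenius_det_rep x)

variable (p n) in
/-- The reduced norm. -/
def reducedNorm : 𝒪 →* ℤ_[p] where
  toFun x := (exists_ofPadic_eq_det x).choose
  map_one' := ofPadic_injective (n := n) (by
    rw [(exists_ofPadic_eq_det _).choose_spec]; simp)
  map_mul' x y := ofPadic_injective (n := n) (by
    simp only [map_mul (ofPadic p n), (exists_ofPadic_eq_det _).choose_spec]; simp)

theorem ofPadic_reducedNorm (x : 𝒪) : ofPadic p n (reducedNorm p n x) = (rep p n x).det :=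
  (exists_ofPadic_eq_det x).choose_spec

theorem toZMod_reducedNorm (x : 𝒪) :
    PadicInt.toZMod (reducedNorm p n x) = Algebra.norm (ZMod p) (residue p n x) := by
  apply (algebraMap (ZMod p) 𝔽).injective
  rw [← ofPadic_coeff_zero, ofPadic_reducedNorm, det_rep_coeff_zero]

/-! ### The `p`-adic topology and compactness -/

omit [NeZero n] in
theorem hasBasis_nhds (x : 𝒪) :
    (𝓝 x).HasBasis (fun _ : ℕ => True) fun m => {y | ∃ z, y = x + (p : 𝒪) ^ m * z} := by
  have h := (padic_ringSubgroupsBasis p 𝒪).hasBasis_nhds x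
  refine h.congr (by simp) fun m _ => ?_
  ext y
  simp only [Set.mem_ofPred_eq, AddMonoidHom.mem_range, AddMonoidHom.coe_mulLeft,
    eq_comm (b := y - x), sub_eq_iff_eq_add']

omit [NeZero n] in
theorem continuous_of_add_eq {X : Type*} [TopologicalSpace X] (f : 𝒪 → X) (m : ℕ)
    (h : ∀ x z, f (x + (p : 𝒪) ^ m * z) = f x) : Continuous f := by
  refine (IsLocallyConstant.iff_eventually_eq f).2 (fun x => ?_) |>.continuous
  filter_upwards [(hasBasis_nhds x).mem_of_mem (i := m) trivial]
  rintro _ ⟨z, rfl⟩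
  exact h x z

theorem continuous_residue : Continuous (residue p n) :=
  continuous_of_add_eq _ 1 fun x z => by simp

omit [NeZero n] in
theorem forall_coeff_eq_iff {v w : 𝕎} {m : ℕ} :
    (∀ i < m, v.coeff i = w.coeff i) ↔ ∃ u, v = w + p ^ m * u := by
  rw [le_coeff_eq_iff_le_sub_coeff_eq_zero, ← mem_span_p_pow_iff_le_coeff_eq_zero,
    Ideal.mem_span_singleton, dvd_def]
  simp only [sub_eq_iff_eq_add']

omit [Fact p.Prime] [NeZero n] in
theorem natCast_pow_mul_apply {R : Type*} [Ring R] (m : ℕ) (A : Matrix (Fin n) (Fin n) R)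
    (i j : Fin n) : ((p : Matrix (Fin n) (Fin n) R) ^ m * A) i j = (p : R) ^ m * A i j := by
  rw [← Nat.cast_pow, ← nsmul_eq_mul, Matrix.smul_apply, nsmul_eq_mul, Nat.cast_pow]

theorem continuous_rep_coeff (a b : Fin n) (i : ℕ) :
    Continuous fun x : 𝒪 => (rep p n x a b).coeff i := by
  refine continuous_of_add_eq _ (i + 1) fun x z => ?_
  refine forall_coeff_eq_iff.2 ⟨rep p n z a b, ?_⟩ i i.lt_succ_self
  rw [map_add, Matrix.add_apply, map_mul, map_pow, map_natCast, natCast_pow_mul_apply]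

instance : T2Space 𝒪 := by
  refine .of_injective_continuous (f := fun (x : 𝒪) (j : Fin n) i => (rep p n x 0 j).coeff i)
    (fun x y h => ?_) (continuous_pi fun j => continuous_pi fun i => continuous_rep_coeff 0 j i)
  rw [eq_sum_coord x, eq_sum_coord y]
  refine Finset.sum_congr rfl fun j _ => ?_
  congr 2
  exact WittVector.ext fun i => congrFun (congrFun h j) i

/-- The order is the continuous image of the compact space of Witt coefficient sequences: `m`
coefficients determine a Witt vector modulo `p^m`. -/
instance : CompactSpace 𝒪 := by
  let f (c : Fin n → ℕ → 𝔽) : 𝒪 := ∑ j, ι (WittVector.mk p (c j)) * ϖ ^ (j : ℕ)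
  have hf : Function.Surjective f := fun x =>
    ⟨fun j => (rep p n x 0 j).coeff, (eq_sum_coord x).symm⟩
  have hc : Continuous f := by
    refine continuous_iff_continuousAt.2 fun c => (hasBasis_nhds _).tendsto_right_iff.2 fun m _ => ?_
    have h : ∀ᶠ d in 𝓝 c, ∀ j, ∀ i ∈ Finset.range m, d j i = c j i := by
      refine Filter.eventually_all.2 fun j => (Filter.eventually_all_finset _).2 fun i _ => ?_
      have hd : Continuous fun d : Fin n → ℕ → 𝔽 => d j i := by fun_prop
      exact hd.continuousAt.eventually (p := fun a => a = c j i) (by simp [nhds_discrete])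
    filter_upwards [h] with d hd
    have hd (j : Fin n) : ∃ u, WittVector.mk p (d j) = WittVector.mk p (c j) + p ^ m * u :=
      forall_coeff_eq_iff.1 fun i hi => hd j i (Finset.mem_range.2 hi)
    choose u hu using hd
    refine ⟨∑ j, ι (u j) * ϖ ^ (j : ℕ), ?_⟩
    simp [f, hu, add_mul, Finset.sum_add_distrib, Finset.mul_sum, mul_assoc]
  rw [← isCompact_univ_iff, ← hf.range_eq]
  exact isCompact_range hc

theorem exists_pow_eq_mul_unif_pow {x : 𝒪} (h : residue p n x = 0) (i : ℕ) :
    ∃ y, x ^ i = y * ϖ ^ i := by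
  induction i with
  | zero => exact ⟨1, by simp⟩
  | succ i ih =>
    obtain ⟨y, hy⟩ := ih
    obtain ⟨z, rfl⟩ := exists_eq_mul_unif h
    obtain ⟨z', hz, -⟩ := exists_unif_pow_mul i z
    exact ⟨y * z', by rw [pow_succ, hy, mul_assoc, ← mul_assoc (ϖ ^ i), hz, pow_succ]; noncomm_ring⟩

/-- Partial geometric sums in `1 - x` are approximate inverses, and the right ideal `x O` is closed
because it is compact. -/
theorem exists_mul_eq_one {x : 𝒪} (h : residue p n x = 1) : ∃ y, x * y = 1 := by
  have hc : IsClosed (Set.range fun y => x * y) :=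
    (isCompact_range (continuous_const.mul continuous_id)).isClosed
  have h1 : (1 : 𝒪) ∈ closure (Set.range fun y => x * y) := by
    refine mem_closure_iff_nhds_basis (hasBasis_nhds _) |>.2 fun m _ => ?_
    obtain ⟨z, hz⟩ := exists_pow_eq_mul_unif_pow (x := 1 - x) (by simp [h]) (n * m)
    refine ⟨x * ∑ i ∈ Finset.range (n * m), (1 - x) ^ i,
      ⟨∑ i ∈ Finset.range (n * m), (1 - x) ^ i, rfl⟩, -z, ?_⟩
    have := mul_neg_geom_sum (1 - x) (n * m)
    rw [sub_sub_cancel] at this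
    rw [this, hz, pow_mul, unif_pow, sub_eq_add_neg, mul_neg,
      ((Nat.cast_commute p z).pow_left m).eq]
  rw [hc.closure_eq] at h1
  exact h1

theorem isUnit_of_residue_eq_one {x : 𝒪} (h : residue p n x = 1) : IsUnit x := by
  obtain ⟨y, hy⟩ := exists_mul_eq_one h
  have h' : residue p n y = 1 := by simpa [h] using congrArg (residue p n) hy
  obtain ⟨z, hz⟩ := exists_mul_eq_one h'
  have : x = z := by rw [← mul_one x, ← hz, ← mul_assoc, hy, one_mul]
  exact ⟨⟨x, y, hy, this ▸ hz⟩, rfl⟩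

/-! ### Continuity and leading term of the reduced norm -/

omit [NeZero n] in
theorem pow_dvd_of_ofPadic {u : ℤ_[p]} {m : ℕ} (h : (p : 𝕎) ^ m ∣ ofPadic p n u) :
    (p : ℤ_[p]) ^ m ∣ u := by
  rw [← Ideal.mem_span_singleton, mem_span_p_pow_iff_le_coeff_eq_zero] at h
  have h' : (p : WittVector p (ZMod p)) ^ m ∣ (WittVector.equiv p).symm u := by
    rw [← Ideal.mem_span_singleton, mem_span_p_pow_iff_le_coeff_eq_zero]
    intro i hi
    apply (algebraMap (ZMod p) 𝔽).injective
    simpa [ofPadic, WittVector.map_coeff] using h i hi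
  simpa using map_dvd (WittVector.equiv p) h'

theorem pow_dvd_reducedNorm_sub (x z : 𝒪) (m : ℕ) :
    (p : ℤ_[p]) ^ m ∣ reducedNorm p n (x + (p : 𝒪) ^ m * z) - reducedNorm p n x := by
  apply pow_dvd_of_ofPadic (n := n)
  rw [map_sub, ofPadic_reducedNorm, ofPadic_reducedNorm, ← Ideal.mem_span_singleton,
    ← Ideal.Quotient.eq, RingHom.map_det, RingHom.map_det, map_add, map_add]
  congr 1
  rw [add_eq_left, map_mul, map_mul, map_pow, map_pow, map_natCast, map_natCast]
  ext1 i j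
  rw [natCast_pow_mul_apply, Matrix.zero_apply,
    ← map_natCast (Ideal.Quotient.mk (Ideal.span {(p : 𝕎) ^ m})), ← map_pow,
    Ideal.Quotient.eq_zero_iff_mem.2 (Ideal.mem_span_singleton_self _), zero_mul]

theorem continuous_reducedNorm : Continuous (reducedNorm p n) := by
  refine continuous_iff_continuousAt.2 fun x => Metric.tendsto_nhds.2 fun ε hε => ?_
  obtain ⟨m, hm⟩ := PadicInt.exists_pow_neg_lt p hε
  filter_upwards [(hasBasis_nhds x).mem_of_mem (i := m) trivial]
  rintro _ ⟨z, rfl⟩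
  rw [dist_eq_norm]
  refine lt_of_le_of_lt ?_ hm
  rw [PadicInt.norm_le_pow_iff_mem_span_pow, Ideal.mem_span_singleton]
  exact pow_dvd_reducedNorm_sub x z m

omit [NeZero n] in
theorem coeff_zero_one_add_p_mul (a v : 𝕎) : (a + p * v).coeff 0 = a.coeff 0 :=
  forall_coeff_eq_iff.2 ⟨v, by rw [pow_one]⟩ 0 one_pos

theorem trace_rep_coeff_zero (x : 𝒪) :
    (rep p n x).trace.coeff 0 = algebraMap (ZMod p) 𝔽 (Algebra.trace (ZMod p) 𝔽 (residue p n x)) := by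
  rw [FiniteField.algebraMap_trace_eq_sum_pow, GaloisField.finrank p (NeZero.ne n), Nat.card_zmod,
    ← WittVector.constantCoeff_apply, Matrix.trace, map_sum, Finset.sum_range]
  refine Finset.sum_congr rfl fun i _ => ?_
  simp [rep_coeff_zero]

theorem reducedNorm_one_add (z : 𝒪) {m : ℕ} (hm : 1 ≤ m) :
    ∃ t : ℤ_[p], reducedNorm p n (1 + (p : 𝒪) ^ m * z) = 1 + p ^ m * t ∧
      PadicInt.toZMod t = Algebra.trace (ZMod p) 𝔽 (residue p n z) := by
  obtain ⟨t, ht⟩ := pow_dvd_reducedNorm_sub 1 z m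
  rw [map_one, sub_eq_iff_eq_add'] at ht
  refine ⟨t, ht, (algebraMap (ZMod p) 𝔽).injective ?_⟩
  have h := congrArg (ofPadic p n) ht
  have hM : rep p n (1 + (p : 𝒪) ^ m * z) = 1 + (p : 𝕎) ^ m • rep p n z := by
    ext1 i j
    rw [map_add, map_one, map_mul, map_pow, map_natCast, Matrix.add_apply, natCast_pow_mul_apply]
    rfl
  rw [ofPadic_reducedNorm, hM, Matrix.det_one_add_smul, map_add, map_one, map_mul, map_pow,
    map_natCast, add_assoc, add_right_inj] at h
  -- Only the linear term of the determinant matters: `q` comes with `p^(2m)`, which `p^(m+1)`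
  -- divides because `m ≥ 1`.
  generalize Polynomial.eval _ (_ : Polynomial 𝕎) = q at h
  obtain ⟨m, rfl⟩ := Nat.exists_eq_add_of_le' hm
  have h' : (p : 𝕎) ^ (m + 1) * ofPadic p n t =
      (p : 𝕎) ^ (m + 1) * ((rep p n z).trace + p * (p ^ m * q)) := by
    rw [← h]; ring
  have := mul_left_cancel₀ (pow_ne_zero _ natCast_ne_zero) h'
  rw [← ofPadic_coeff_zero, this, coeff_zero_one_add_p_mul, trace_rep_coeff_zero]

/-! ### Commutators in the filtration of the unit group -/

omit [NeZero n] in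
theorem exists_pow_sub_eq {a : 𝔽} (h : Algebra.trace (ZMod p) 𝔽 a = 0) : ∃ b, b ^ p - b = a := by
  -- Additive Hilbert 90 by dimension count: the image of `L` lies in the trace-zero hyperplane, and
  -- its kernel is at most the line `F_p`.
  let L : 𝔽 →ₗ[ZMod p] 𝔽 := (FiniteField.frobeniusAlgHom (ZMod p) 𝔽).toLinearMap - LinearMap.id
  have hL (b : 𝔽) : L b = b ^ p - b := by
    simp [L, ZMod.card]
  have hle : LinearMap.range L ≤ LinearMap.ker (Algebra.trace (ZMod p) 𝔽) := by
    rintro _ ⟨b, rfl⟩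
    rw [LinearMap.mem_ker, hL, map_sub, sub_eq_zero]
    have := Algebra.trace_eq_of_algEquiv (FiniteField.frobeniusAlgEquivOfAlgebraic (ZMod p) 𝔽) b
    rwa [FiniteField.coe_frobeniusAlgEquivOfAlgebraic, ZMod.card] at this
  have hker : Module.finrank (ZMod p) (LinearMap.ker L) ≤ 1 := by
    refine finrank_le_one (⟨1, by simp [hL]⟩ : LinearMap.ker L) fun ⟨b, hb⟩ => ?_
    rw [LinearMap.mem_ker, hL, sub_eq_zero, ← Subfield.mem_bot_iff_pow_eq_self,
      mem_bot_iff_intCast p] at hb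
    obtain ⟨m, rfl⟩ := hb
    exact ⟨m, by ext; simp [Algebra.smul_def]⟩
  have h1 := LinearMap.finrank_range_add_finrank_ker L
  have h2 := LinearMap.finrank_range_add_finrank_ker (Algebra.trace (ZMod p) 𝔽)
  rw [LinearMap.range_eq_top.2 (Algebra.trace_surjective (ZMod p) 𝔽), finrank_top,
    Module.finrank_self] at h2
  have heq := Submodule.eq_of_le_of_finrank_le hle (by omega)
  obtain ⟨b, hb⟩ : a ∈ LinearMap.range L := heq ▸ h
  exact ⟨b, by rw [← hL, hb]⟩

theorem exists_pow_ne {i : ℕ} (hi : ¬ n ∣ i) : ∃ ω : 𝔽, ω ^ p ^ i ≠ ω := by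
  by_contra! h
  refine hi ?_
  rw [← GaloisField.finrank p (NeZero.ne n), ← FiniteField.orderOf_frobeniusAlgHom (ZMod p) 𝔽,
    orderOf_dvd_iff_pow_eq_one]
  ext x
  rw [AlgHom.coe_pow, FiniteField.coe_frobeniusAlgHom, pow_iterate, ZMod.card]
  exact h x

variable (p n) in
/-- Teichmüller representatives in the order. -/
def teich : 𝔽 →* 𝒪 := (ι : 𝕎 →* 𝒪).comp (teichmuller p)

theorem residue_teich (a : 𝔽) : residue p n (teich p n a) = a :=
  (residue_ofWitt _).trans (teichmuller_coeff_zero p a)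

theorem residue_units_inv (u : 𝒪ˣ) : residue p n ↑u⁻¹ = (residue p n u)⁻¹ :=
  (map_units_inv (residue p n) u)

theorem exists_unit {i : ℕ} (hi : 1 ≤ i) (z : 𝒪) : ∃ u : 𝒪ˣ, (u : 𝒪) = 1 + z * ϖ ^ i :=
  isUnit_of_residue_eq_one (by simp [residue_unif, Nat.one_le_iff_ne_zero.1 hi])

-- `⁅u, v⁆ - 1 = (uv - vu) u⁻¹ v⁻¹`; moving `S^i` to the right past the inverses twists their
-- residues by the `p^i`-th power.
open scoped commutatorElement in
theorem commutator_eq {u v : 𝒪ˣ} {t : 𝒪} {i : ℕ} (h : (u * v - v * u : 𝒪) = t * ϖ ^ i) :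
    ∃ y, (⁅u, v⁆ : 𝒪ˣ) = 1 + y * ϖ ^ i ∧
      residue p n y = residue p n t * (residue p n u * residue p n v)⁻¹ ^ p ^ i := by
  obtain ⟨w, hw, hw'⟩ := exists_unif_pow_mul i ((u⁻¹ * v⁻¹ : 𝒪ˣ) : 𝒪)
  refine ⟨t * w, ?_, ?_⟩
  · rw [mul_assoc, ← hw, ← mul_assoc, ← h, commutatorElement_def, sub_mul]
    have : (v * u * ↑(u⁻¹ * v⁻¹) : 𝒪) = 1 := by
      rw [← Units.val_mul, ← Units.val_mul]; simp
    rw [this]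
    simp [mul_assoc]
  · rw [map_mul, hw', Units.val_mul, map_mul, residue_units_inv, residue_units_inv, mul_inv]

open scoped commutatorElement in
theorem exists_commutator_of_not_dvd {i : ℕ} (hi : ¬ n ∣ i) (a : 𝔽) :
    ∃ c ∈ commutator 𝒪ˣ, ∃ y, (c : 𝒪) = 1 + y * ϖ ^ i ∧ residue p n y = a := by
  obtain ⟨ω, hω⟩ := exists_pow_ne (p := p) hi
  have hi1 : 1 ≤ i := Nat.one_le_iff_ne_zero.2 fun h => hi (h ▸ dvd_zero n)
  have h0 : ω ≠ 0 := by
    rintro rfl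
    exact hω (zero_pow (pow_ne_zero _ (Fact.out : p.Prime).ne_zero))
  let g : 𝒪ˣ := Units.map (teich p n) (Units.mk0 ω h0)
  have hg : residue p n g = ω := residue_teich ω
  obtain ⟨g', hg1, hg2⟩ := exists_unif_pow_mul i (g : 𝒪)
  -- The commutator of `g` and `1 + z S^i` has leading residue `(ω - ω^(p^i)) z / ω^(p^i)`; solve
  -- for the value `a`.
  let z : 𝒪 := teich p n (a * ω ^ p ^ i / (ω - ω ^ p ^ i))
  obtain ⟨h, hh⟩ := exists_unit hi1 z
  have hh1 : residue p n h = 1 := by simp [hh, residue_unif, Nat.one_le_iff_ne_zero.1 hi1]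
  have key : (g * h - h * g : 𝒪) = (g * z - z * g') * ϖ ^ i := by
    rw [hh, mul_add, add_mul, sub_mul, mul_assoc z, mul_assoc z, hg1]
    simp [mul_assoc]
  obtain ⟨y, hy, hy'⟩ := commutator_eq key
  refine ⟨⁅g, h⁆, Subgroup.commutator_mem_commutator trivial trivial, y, hy, ?_⟩
  rw [hy', map_sub, map_mul, map_mul, hg, hg2, hg, hh1, residue_teich, mul_one, inv_pow]
  have : ω - ω ^ p ^ i ≠ 0 := sub_ne_zero.2 hω.symm
  field_simp

open scoped commutatorElement in
theorem exists_commutator_pow_sub {i : ℕ} (hi : 1 ≤ i) (b : 𝔽) :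
    ∃ c ∈ commutator 𝒪ˣ, ∃ y, (c : 𝒪) = 1 + y * ϖ ^ (i + 1) ∧ residue p n y = b ^ p - b := by
  obtain ⟨u, hu⟩ := exists_unit (p := p) (n := n) le_rfl 1
  obtain ⟨v, hv⟩ := exists_unit hi (teich p n b)
  obtain ⟨z, hz1, hz2⟩ := exists_unif_mul (teich p n b)
  have hu1 : residue p n u = 1 := by simp [hu, residue_unif]
  have hv1 : residue p n v = 1 := by simp [hv, residue_unif, Nat.one_le_iff_ne_zero.1 hi]
  -- With `u = 1 + S` and `v = 1 + b S^i`, only `S b S^i - b S^(i+1)` survives, and `S b = z S` with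
  -- `z` of residue `b^p`.
  have key : (u * v - v * u : 𝒪) = (z - teich p n b) * ϖ ^ (i + 1) := by
    rw [hu, hv, sub_mul, pow_succ' ϖ i, ← mul_assoc z, ← hz1, ← pow_succ', pow_succ ϖ i]
    noncomm_ring
  obtain ⟨y, hy, hy'⟩ := commutator_eq key
  refine ⟨⁅u, v⁆, Subgroup.commutator_mem_commutator trivial trivial, y, hy, ?_⟩
  rw [hy', map_sub, hz2, residue_teich, hu1, hv1]
  simp

variable (p n) in
/-- The reduced norm on the group of units. -/
def unitsNorm : 𝒪ˣ →* ℤ_[p]ˣ := Units.map (reducedNorm p n)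

variable (p n) in
/-- The residue map on the group of units. -/
def unitsResidue : 𝒪ˣ →* 𝔽ˣ := Units.map (residue p n : 𝒪 →* 𝔽)

theorem exists_commutator {x : 𝒪ˣ} (hx : unitsNorm p n x = 1) {i : ℕ} (hi : 1 ≤ i) {y : 𝒪}
    (hy : (x : 𝒪) = 1 + y * ϖ ^ i) :
    ∃ c ∈ commutator 𝒪ˣ, ∃ y', (c : 𝒪) = 1 + y' * ϖ ^ i ∧ residue p n y' = residue p n y := by
  by_cases hni : n ∣ i
  swap
  · exact exists_commutator_of_not_dvd hni _
  obtain ⟨m, rfl⟩ := hni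
  have hm : 1 ≤ m := by
    rw [Nat.one_le_iff_ne_zero]
    rintro rfl
    simp at hi
  have htr : Algebra.trace (ZMod p) 𝔽 (residue p n y) = 0 := by
    obtain ⟨t, ht, ht'⟩ := reducedNorm_one_add y hm
    have h1 : (x : 𝒪) = 1 + (p : 𝒪) ^ m * y := by
      rw [hy, pow_mul, unif_pow, ((Nat.cast_commute p y).pow_left m).eq]
    have h2 : reducedNorm p n x = 1 := congrArg Units.val hx
    rw [← h1, h2, left_eq_add, mul_eq_zero] at ht
    rcases ht with ht | ht
    · exact absurd ht (pow_ne_zero _ (Nat.cast_ne_zero.2 (Fact.out : p.Prime).ne_zero))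
    · rw [← ht', ht, map_zero]
  obtain ⟨b, hb⟩ := exists_pow_sub_eq htr
  by_cases h1 : n * m = 1
  -- In layer `1` with `n = 1` there is no lower layer to commute with, but then `b^p = b` and the
  -- required residue is `0`.
  · refine ⟨1, one_mem _, 0, by simp, ?_⟩
    have hn : n = 1 := Nat.dvd_one.1 ⟨m, h1.symm⟩
    have := galoisField_pow (p := p) b
    rw [show p ^ n = p by rw [hn, pow_one]] at this
    rw [← hb, this, sub_self, map_zero]
  · obtain ⟨j, hj⟩ := Nat.exists_eq_add_of_le' hi
    rw [hj, ← hb]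
    exact exists_commutator_pow_sub (by omega) b

theorem commutator_le_ker {G A : Type*} [Group G] [CommGroup A] (f : G →* A) :
    commutator G ≤ f.ker :=
  Abelianization.commutator_subset_ker f

theorem exists_commutator_approx {x : 𝒪ˣ} (hx : unitsNorm p n x = 1)
    (hr : unitsResidue p n x = 1) (i : ℕ) :
    ∃ c ∈ commutator 𝒪ˣ, ∃ y, ((c⁻¹ * x : 𝒪ˣ) : 𝒪) = 1 + y * ϖ ^ (i + 1) := by
  induction i with
  | zero =>
    have hr : residue p n x = 1 := congrArg Units.val hr
    obtain ⟨y, hy⟩ := exists_eq_mul_unif (x := (x : 𝒪) - 1) (by simp [hr])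
    exact ⟨1, one_mem _, y, by rw [pow_one, ← hy]; simp⟩
  | succ i ih =>
    obtain ⟨c, hc, y, hy⟩ := ih
    have hn : unitsNorm p n (c⁻¹ * x) = 1 := by
      rw [map_mul, hx, mul_one]
      exact commutator_le_ker _ (inv_mem hc)
    obtain ⟨d, hd, z, hz, hzy⟩ := exists_commutator hn (by omega) hy
    obtain ⟨w, hw⟩ := exists_eq_mul_unif (x := y - z) (by simp [hzy])
    refine ⟨c * d, mul_mem hc hd, ↑d⁻¹ * w, ?_⟩
    have : ((c⁻¹ * x : 𝒪ˣ) : 𝒪) = d + w * ϖ ^ (i + 1 + 1) := by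
      rw [hy, hz, pow_succ' _ (i + 1), ← mul_assoc w, ← hw]
      noncomm_ring
    rw [mul_inv_rev, mul_assoc, Units.val_mul, this, mul_add, Units.inv_mul, mul_assoc]

theorem mem_closure_commutator {x : 𝒪ˣ} (hx : unitsNorm p n x = 1)
    (hr : unitsResidue p n x = 1) : x ∈ (commutator 𝒪ˣ).topologicalClosure := by
  have h (m : ℕ) : ∃ c ∈ commutator 𝒪ˣ, ∃ y, ((c⁻¹ * x : 𝒪ˣ) : 𝒪) = 1 + p ^ m * y := by
    obtain ⟨c, hc, y, hy⟩ := exists_commutator_approx hx hr (n * m)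
    refine ⟨c, hc, y * ϖ, ?_⟩
    rw [hy, pow_succ', pow_mul, unif_pow, ← mul_assoc, ((Nat.cast_commute p (y * ϖ)).pow_left m).eq]
  choose c hc y hy using h
  have hlim (a : ℕ → 𝒪) (b : 𝒪) (h : ∀ m, ∃ z, a m = b + (p : 𝒪) ^ m * z) :
      Filter.Tendsto a Filter.atTop (𝓝 b) := by
    refine (hasBasis_nhds b).tendsto_right_iff.2 fun m _ => ?_
    filter_upwards [Filter.eventually_ge_atTop m] with l hl
    obtain ⟨z, hz⟩ := h l
    refine ⟨p ^ (l - m) * z, ?_⟩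
    rw [hz, ← mul_assoc, ← pow_add, Nat.add_sub_cancel' hl]
  refine mem_closure_of_tendsto (f := c) (b := Filter.atTop) ?_ (.of_forall hc)
  -- In the topology on units the inverses must converge as well.
  rw [Units.isEmbedding_embedProduct.tendsto_nhds_iff]
  refine Filter.Tendsto.prodMk_nhds (hlim _ _ fun m => ?_)
    ((MulOpposite.continuous_op.tendsto _).comp (hlim _ _ fun m => ?_))
  · refine ⟨-(c m * y m), ?_⟩
    have : (x : 𝒪) = c m * ((c m)⁻¹ * x : 𝒪ˣ) := by rw [← Units.val_mul]; simp
    rw [this, hy, mul_add, ← mul_assoc, ← ((Nat.cast_commute p (c m : 𝒪)).pow_left m).eq]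
    simp [mul_assoc]
  · refine ⟨y m * ↑x⁻¹, ?_⟩
    have : (((c m)⁻¹ : 𝒪ˣ) : 𝒪) = ((c m)⁻¹ * x : 𝒪ˣ) * ↑x⁻¹ := by rw [← Units.val_mul]; simp
    rw [this, hy, add_mul, one_mul, mul_assoc]

/-! ### Surjectivity onto the fibre product, and the kernel -/

theorem exists_reducedNorm_eq {u : ℤ_[p]} (hu : PadicInt.toZMod u = 1) :
    ∃ x, residue p n x = 1 ∧ reducedNorm p n x = u := by
  have hA : IsClosed {x : 𝒪 | residue p n x = 1} :=
    isClosed_singleton.preimage continuous_residue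
  have hc : IsClosed (reducedNorm p n '' {x : 𝒪 | residue p n x = 1}) :=
    (hA.isCompact.image continuous_reducedNorm).isClosed
  suffices h : u ∈ closure (reducedNorm p n '' {x : 𝒪 | residue p n x = 1}) by
    rw [hc.closure_eq] at h
    exact h
  have key (m : ℕ) : ∃ x : 𝒪, residue p n x = 1 ∧ (p : ℤ_[p]) ^ (m + 1) ∣ reducedNorm p n x - u := by
    induction m with
    | zero =>
      refine ⟨1, map_one _, ?_⟩
      rw [map_one, zero_add, pow_one, ← Ideal.mem_span_singleton, ← PadicInt.maximalIdeal_eq_span_p,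
        ← PadicInt.ker_toZMod, RingHom.mem_ker, map_sub, hu, map_one, sub_self]
    | succ m ih =>
      obtain ⟨x, hx, s, hs⟩ := ih
      -- The factor `1 + p^(m+1) b` changes the norm by `p^(m+1) Tr(b)` to leading order, which
      -- cancels the error `p^(m+1) s`.
      obtain ⟨b, hb⟩ := Algebra.trace_surjective (ZMod p) 𝔽 (-PadicInt.toZMod s)
      obtain ⟨t, ht, ht'⟩ := reducedNorm_one_add (teich p n b) (Nat.le_add_left 1 m)
      refine ⟨x * (1 + (p : 𝒪) ^ (m + 1) * teich p n b), by simp [hx], ?_⟩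
      have h0 : PadicInt.toZMod (s + reducedNorm p n x * t) = 0 := by
        rw [map_add, map_mul, toZMod_reducedNorm, hx, ht', residue_teich, hb, map_one, one_mul,
          add_neg_cancel]
      rw [← RingHom.mem_ker, PadicInt.ker_toZMod, PadicInt.maximalIdeal_eq_span_p,
        Ideal.mem_span_singleton] at h0
      have : reducedNorm p n (x * (1 + (p : 𝒪) ^ (m + 1) * teich p n b)) - u =
          p ^ (m + 1) * (s + reducedNorm p n x * t) := by
        rw [map_mul, ht]; linear_combination hs
      rw [this, pow_succ _ (m + 1)]
      exact mul_dvd_mul_left _ h0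
  refine Metric.mem_closure_iff.2 fun ε hε => ?_
  obtain ⟨m, hm⟩ := PadicInt.exists_pow_neg_lt p hε
  obtain ⟨x, hx, hx'⟩ := key m
  refine ⟨_, ⟨x, hx, rfl⟩, ?_⟩
  rw [dist_comm, dist_eq_norm]
  refine lt_of_le_of_lt ?_ hm
  rw [PadicInt.norm_le_pow_iff_mem_span_pow, Ideal.mem_span_singleton]
  exact (pow_dvd_pow _ m.le_succ).trans hx'

variable (p n) in
/-- The reduced norm and the residue, as a map to the fibre product. -/
def toFibreProduct : 𝒪ˣ →* unitsFibreProduct p n :=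
  ((unitsNorm p n).prod (unitsResidue p n)).codRestrict _ fun x =>
    Units.ext (toZMod_reducedNorm (x : 𝒪))

theorem continuous_toFibreProduct : Continuous (toFibreProduct p n) :=
  .subtype_mk ((continuous_reducedNorm.units_map _).prodMk (continuous_residue.units_map _)) _

theorem toFibreProduct_surjective : Function.Surjective (toFibreProduct p n) := by
  rintro ⟨⟨u, a⟩, hua⟩
  -- A Teichmüller lift realizes the residue `a`; what remains is a principal unit of `ℤ_p`, a norm
  -- from residue `1`.
  let g : 𝒪ˣ := Units.map (teich p n) a
  have hga : unitsResidue p n g = a := Units.ext (residue_teich (a : 𝔽))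
  have hu : PadicInt.toZMod ((u * (unitsNorm p n g)⁻¹ : ℤ_[p]ˣ) : ℤ_[p]) = 1 := by
    have h1 : Units.map ((PadicInt.toZMod : ℤ_[p] →+* ZMod p) : ℤ_[p] →* ZMod p) u =
      Units.map (Algebra.norm (ZMod p) : 𝔽 →* ZMod p) a := hua
    have h2 : Units.map ((PadicInt.toZMod : ℤ_[p] →+* ZMod p) : ℤ_[p] →* ZMod p) (unitsNorm p n g) =
        Units.map (Algebra.norm (ZMod p) : 𝔽 →* ZMod p) a := by
      rw [← hga]
      exact Units.ext (toZMod_reducedNorm (g : 𝒪))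
    have h3 := map_mul_inv (Units.map ((PadicInt.toZMod : ℤ_[p] →+* ZMod p) : ℤ_[p] →* ZMod p)) u
      (unitsNorm p n g)
    rw [h1, h2, mul_inv_cancel] at h3
    exact congrArg Units.val h3
  obtain ⟨x, hx, hx'⟩ := exists_reducedNorm_eq (n := n) hu
  obtain ⟨x, rfl⟩ := isUnit_of_residue_eq_one hx
  have h1 : unitsNorm p n x = u * (unitsNorm p n g)⁻¹ := Units.ext hx'
  have h2 : unitsResidue p n x = 1 := Units.ext hx
  refine ⟨x * g, Subtype.ext (Prod.ext ?_ ?_)⟩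
  · change unitsNorm p n (x * g) = u
    rw [map_mul, h1, inv_mul_cancel_right]
  · change unitsResidue p n (x * g) = a
    rw [map_mul, h2, hga, one_mul]

theorem ker_toFibreProduct :
    (toFibreProduct p n).ker = (commutator 𝒪ˣ).topologicalClosure := by
  apply le_antisymm
  · intro x hx
    have h := congrArg Subtype.val hx
    exact mem_closure_commutator (congrArg Prod.fst h) (congrArg Prod.snd h)
  · refine Subgroup.topologicalClosure_minimal _ (commutator_le_ker _) ?_
    exact isClosed_singleton.preimage continuous_toFibreProduct

end Galois

end MoravaOrder

/-- A continuous bijective homomorphism from a compact group to a Hausdorff group is an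
isomorphism of topological groups. -/
def continuousMulEquivOfBijective {G H : Type*} [Group G] [Group H] [TopologicalSpace G]
    [TopologicalSpace H] [CompactSpace G] [T2Space H] (f : G →* H) (hf : Continuous f)
    (hb : Function.Bijective f) : G ≃ₜ* H where
  __ := MulEquiv.ofBijective f hb
  continuous_toFun := hf
  continuous_invFun :=
    (Continuous.homeoOfEquivCompactToT2 (f := (MulEquiv.ofBijective f hb).toEquiv) hf).symm.continuous

/-! ### Splitting off the Teichmüller part of `ℤ_p^×` -/

section Padic

variable {p : ℕ} [Fact p.Prime]

theorem PadicInt.toZMod_eq_zero_iff (x : ℤ_[p]) : toZMod x = 0 ↔ (p : ℤ_[p]) ∣ x := by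
  rw [← RingHom.mem_ker, ker_toZMod, maximalIdeal_eq_span_p, Ideal.mem_span_singleton]

theorem PadicInt.continuous_toZMod : Continuous (toZMod : ℤ_[p] →+* ZMod p) := by
  refine (IsLocallyConstant.iff_eventually_eq _).2 (fun x => ?_) |>.continuous
  filter_upwards [Metric.ball_mem_nhds x one_pos] with y hy
  rw [mem_ball_iff_norm, PadicInt.norm_lt_one_iff_dvd, ← toZMod_eq_zero_iff, map_sub] at hy
  exact sub_eq_zero.1 hy

variable (p) in
/-- Reduction modulo `p` on units. -/
def padicUnitsReduction : ℤ_[p]ˣ →* (ZMod p)ˣ :=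
  Units.map ((PadicInt.toZMod : ℤ_[p] →+* ZMod p) : ℤ_[p] →* ZMod p)

theorem continuous_padicUnitsReduction : Continuous (padicUnitsReduction p) :=
  PadicInt.continuous_toZMod.units_map _

theorem padicUnitsReduction_teichmullerUnits (c : (ZMod p)ˣ) :
    padicUnitsReduction p (teichmullerUnits p c) = c := by
  ext
  change PadicInt.toZMod (WittVector.equiv p (WittVector.teichmuller p (c : ZMod p))) = c
  rw [← MoravaOrder.padic_ringHom_zmod_eq
    (WittVector.constantCoeff.comp (WittVector.equiv p).symm.toRingHom)]
  simp

variable (p) in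
/-- The group of principal units `1 + p ℤ_p`. -/
abbrev padicPrincipalUnits : Subgroup ℤ_[p]ˣ := (padicUnitsReduction p).ker

variable (p) in
/-- The projection of a unit to its principal part. -/
def padicPrincipalPart : ℤ_[p]ˣ →* padicPrincipalUnits p :=
  (MonoidHom.id _ / (teichmullerUnits p).comp (padicUnitsReduction p)).codRestrict _ fun u => by
    simp [MonoidHom.mem_ker, padicUnitsReduction_teichmullerUnits]

theorem coe_padicPrincipalPart (u : ℤ_[p]ˣ) : (padicPrincipalPart p u : ℤ_[p]ˣ) =
    u / teichmullerUnits p (padicUnitsReduction p u) := rfl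

theorem padicPrincipalPart_coe (u : padicPrincipalUnits p) :
    padicPrincipalPart p (u : ℤ_[p]ˣ) = u := by
  ext1
  rw [coe_padicPrincipalPart, u.2, map_one, div_one]

theorem padicPrincipalPart_teichmullerUnits (c : (ZMod p)ˣ) :
    padicPrincipalPart p (teichmullerUnits p c) = 1 := by
  ext1
  rw [coe_padicPrincipalPart, padicUnitsReduction_teichmullerUnits, div_self']
  rfl

theorem continuous_padicPrincipalPart : Continuous (padicPrincipalPart p) := by
  have h : Continuous (teichmullerUnits p) := continuous_of_discreteTopology
  have h' : Continuous fun u : ℤ_[p]ˣ => u / teichmullerUnits p (padicUnitsReduction p u) :=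
    continuous_id.div' (h.comp continuous_padicUnitsReduction)
  exact h'.subtype_mk _

variable (p) in
/-- The fibre product is the product of the principal units with the units of the residue field. -/
def unitsFibreProductEquiv (n : ℕ) :
    unitsFibreProduct p n ≃ₜ* padicPrincipalUnits p × (GaloisField p n)ˣ :=
  have hN : Continuous (Units.map (Algebra.norm (ZMod p) : GaloisField p n →* ZMod p)) :=
    continuous_of_discreteTopology
  have : CompactSpace (unitsFibreProduct p n) := isCompact_iff_compactSpace.1
    (isClosed_eq (continuous_padicUnitsReduction.comp continuous_fst)
      (hN.comp continuous_snd)).isCompact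
  continuousMulEquivOfBijective
    (((padicPrincipalPart p).prodMap (MonoidHom.id (GaloisField p n)ˣ)).comp
      (unitsFibreProduct p n).subtype)
    ((continuous_padicPrincipalPart.prodMap continuous_id).comp continuous_subtype_val) (by
      constructor
      · rintro ⟨⟨u, a⟩, hu⟩ ⟨⟨v, b⟩, hv⟩ h
        have h1 := congrArg (fun x => (x.1 : ℤ_[p]ˣ)) h
        have h2 : a = b := congrArg Prod.snd h
        have hu : padicUnitsReduction p u = Units.map (Algebra.norm (ZMod p)) a := hu
        have hv : padicUnitsReduction p v = Units.map (Algebra.norm (ZMod p)) b := hv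
        change u / teichmullerUnits p (padicUnitsReduction p u) =
          v / teichmullerUnits p (padicUnitsReduction p v) at h1
        rw [hu, hv, h2] at h1
        rw [Subtype.mk.injEq, Prod.mk.injEq]
        exact ⟨div_left_injective h1, h2⟩
      · rintro ⟨u, a⟩
        let c := Units.map (Algebra.norm (ZMod p)) a
        refine ⟨⟨(u * teichmullerUnits p c, a), ?_⟩, Prod.ext ?_ rfl⟩
        · change padicUnitsReduction p (u * teichmullerUnits p c) = c
          rw [map_mul, u.2, padicUnitsReduction_teichmullerUnits, one_mul]
        · change padicPrincipalPart p (u * teichmullerUnits p c) = u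
          rw [map_mul, padicPrincipalPart_coe, padicPrincipalPart_teichmullerUnits, mul_one])

variable (p) in
/-- The map inducing the isomorphism `unitsPushoutEquiv`. -/
def unitsPushoutHom (n : ℕ) :
    ℤ_[p]ˣ × (GaloisField p n)ˣ →* padicPrincipalUnits p × (GaloisField p n)ˣ :=
  ((padicPrincipalPart p).comp (MonoidHom.fst _ _)).prod
    (((primeFieldUnits p n).comp ((padicUnitsReduction p).comp (MonoidHom.fst _ _))) *
      MonoidHom.snd _ _)

theorem ker_unitsPushoutHom (n : ℕ) : (unitsPushoutHom p n).ker =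
    ((teichmullerUnits p).prod (primeFieldUnits p n)⁻¹).range := by
  ext ⟨u, a⟩
  constructor
  · intro h
    have h1 : u / teichmullerUnits p (padicUnitsReduction p u) = 1 :=
      congrArg (fun x => (x.1 : ℤ_[p]ˣ)) h
    have h2 : primeFieldUnits p n (padicUnitsReduction p u) * a = 1 := congrArg Prod.snd h
    exact ⟨padicUnitsReduction p u,
      Prod.ext (div_eq_one.1 h1).symm (inv_eq_of_mul_eq_one_right h2)⟩
  · rintro ⟨c, hc⟩
    have h1 : teichmullerUnits p c = u := congrArg Prod.fst hc
    have h2 : (primeFieldUnits p n c)⁻¹ = a := congrArg Prod.snd hc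
    rw [← h1, ← h2]
    refine Prod.ext (padicPrincipalPart_teichmullerUnits c) ?_
    change primeFieldUnits p n (padicUnitsReduction p (teichmullerUnits p c)) *
      (primeFieldUnits p n c)⁻¹ = 1
    rw [padicUnitsReduction_teichmullerUnits, mul_inv_cancel]

theorem continuous_unitsPushoutHom (n : ℕ) : Continuous (unitsPushoutHom p n) := by
  refine (continuous_padicPrincipalPart.comp continuous_fst).prodMk (.mul ?_ continuous_snd)
  have h : Continuous (primeFieldUnits p n) := continuous_of_discreteTopology
  exact h.comp (continuous_padicUnitsReduction.comp continuous_fst)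

theorem unitsPushoutHom_surjective (n : ℕ) : Function.Surjective (unitsPushoutHom p n) := by
  rintro ⟨u, a⟩
  refine ⟨(u, a), Prod.ext (padicPrincipalPart_coe u) ?_⟩
  change primeFieldUnits p n (padicUnitsReduction p u) * a = a
  rw [u.2, map_one, one_mul]

/-- The isomorphism induced by a continuous surjection of a compact group onto a Hausdorff
group. -/
def quotientContinuousMulEquiv {G H : Type*} [Group G] [Group H] [TopologicalSpace G]
    [TopologicalSpace H] [CompactSpace G] [T2Space H] (f : G →* H) (hf : Continuous f)
    (hs : Function.Surjective f) (N : Subgroup G) [N.Normal] (hN : f.ker = N) : G ⧸ N ≃ₜ* H :=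
  continuousMulEquivOfBijective (QuotientGroup.lift N f hN.ge) (continuous_quot_lift _ hf)
    ⟨(MonoidHom.ker_eq_bot_iff _).1 (by
      subst hN
      exact (MonoidHom.ker_eq_bot_iff _).2 (QuotientGroup.kerLift_injective f)),
      QuotientGroup.lift_surjective_of_surjective N f hs hN.ge⟩

variable (p) in
/-- The pushout is the product of the principal units with the units of the residue field. -/
def unitsPushoutEquiv (n : ℕ) :
    UnitsPushout p n ≃ₜ* padicPrincipalUnits p × (GaloisField p n)ˣ :=
  quotientContinuousMulEquiv (unitsPushoutHom p n) (continuous_unitsPushoutHom n)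
    (unitsPushoutHom_surjective n) _ (ker_unitsPushoutHom n)

/-! ### The structure of the principal units -/

namespace PadicInt

theorem tendsto_pow_of_dvd {r : ℤ_[p]} (h : (p : ℤ_[p]) ∣ r) :
    Filter.Tendsto (r ^ ·) Filter.atTop (nhds 0) :=
  tendsto_pow_atTop_nhds_zero_iff_norm_lt_one.2 ((norm_lt_one_iff_dvd r).2 h)

variable {e : ℕ}

variable (p) in
/-- The character `z ↦ (1 + p ^ e) ^ z` of `ℤ_p`. -/
def powChar (he : 1 ≤ e) : AddChar ℤ_[p] ℤ_[p] :=
  addChar_of_value_at_one ((p : ℤ_[p]) ^ e)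
    (tendsto_pow_of_dvd (dvd_pow_self _ (Nat.one_le_iff_ne_zero.1 he)))

variable (he : 1 ≤ e)

theorem continuous_powChar : Continuous (powChar p he) :=
  continuous_addChar_of_value_at_one _

theorem powChar_natCast (m : ℕ) : powChar p he m = (1 + (p : ℤ_[p]) ^ e) ^ m := by
  rw [← nsmul_one, AddChar.map_nsmul_eq_pow, powChar, addChar_of_value_at_one_def]

theorem isClosed_setOf_dvd_sub (m : ℕ) (f : ℤ_[p] → ℤ_[p]) (hf : Continuous f) (u : ℤ_[p]) :
    IsClosed {z | (p : ℤ_[p]) ^ m ∣ f z - u} := by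
  simp only [← Ideal.mem_span_singleton, ← norm_le_pow_iff_mem_span_pow]
  exact isClosed_le (by fun_prop) continuous_const

theorem pow_dvd_powChar_sub_one (z : ℤ_[p]) : (p : ℤ_[p]) ^ e ∣ powChar p he z - 1 := by
  refine denseRange_natCast.induction_on z
    (isClosed_setOf_dvd_sub e _ (continuous_powChar he) 1) fun m => ?_
  rw [powChar_natCast]
  simpa using sub_dvd_pow_sub_pow (1 + (p : ℤ_[p]) ^ e) 1 m

/-- By density of `ℕ` the kernel is an ideal. If it contained `z ≠ 0` it would contain a power of
`p`, making a power of the integer `1 + p^e > 1` equal to `1`. -/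
theorem powChar_eq_one {z : ℤ_[p]} (hz : powChar p he z = 1) : z = 0 := by
  by_contra h0
  have h (y : ℤ_[p]) : powChar p he (y * z) = 1 := by
    refine denseRange_natCast.induction_on y
      (isClosed_eq ((continuous_powChar he).comp (by fun_prop)) continuous_const) fun m => ?_
    rw [← nsmul_eq_mul, AddChar.map_nsmul_eq_pow, hz, one_pow]
  have h1 := h ((unitCoeff h0)⁻¹ : ℤ_[p]ˣ)
  conv at h1 => enter [1, 2, 2]; rw [unitCoeff_spec h0]
  rw [Units.inv_mul_cancel_left, ← Nat.cast_pow, powChar_natCast] at h1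
  have h2 : (1 + p ^ e) ^ p ^ z.valuation = 1 := by exact_mod_cast h1
  have hp := (Fact.out : p.Prime).pos
  exact absurd h2 (Nat.one_lt_pow (pow_pos hp _).ne' (by have := pow_pos hp e; omega)).ne'

theorem exists_one_add_pow_eq {R : Type*} [CommRing R] (a : R) (c : ℕ) :
    ∃ v, (1 + a) ^ c = 1 + c * a + a ^ 2 * v := by
  induction c with
  | zero => exact ⟨0, by simp⟩
  | succ c ih =>
    obtain ⟨v, hv⟩ := ih
    exact ⟨c + v + a * v, by rw [pow_succ, hv]; push_cast; ring⟩

/-- The bound `hpe` gives `(1 + p^e)^(p^m) = 1 + p^(e+m) (1 + p y)`, so powers of it correct an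
approximation one digit at a time. It holds for `e = 1`, `p > 2` and for `e = 2`, `p = 2`. -/
theorem exists_powChar_eq (hpe : e + 2 ≤ e * p) {u : ℤ_[p]} (hu : (p : ℤ_[p]) ^ e ∣ u - 1) :
    ∃ z, powChar p he z = u := by
  have hp : p.Prime := Fact.out
  have key (m : ℕ) : ∃ k : ℕ, (p : ℤ_[p]) ^ (e + m) ∣ (1 + (p : ℤ_[p]) ^ e) ^ k - u := by
    induction m with
    | zero =>
      refine ⟨0, ?_⟩
      rw [pow_zero, add_zero, ← neg_sub]
      exact (dvd_neg).2 hu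
    | succ m ih =>
      obtain ⟨k, s, hs⟩ := ih
      obtain ⟨y, hy⟩ := ZMod.exists_one_add_mul_pow_prime_pow_eq (u := (p : ℤ_[p]) ^ e) (v := p) hp
        (dvd_pow_self _ (Nat.one_le_iff_ne_zero.1 he))
        (by rw [← pow_mul, ← pow_succ', ← pow_succ]; exact pow_dvd_pow _ hpe) 1 m
      -- Multiplying by the `c`-th power of `(1 + p^e)^(p^m)` adds `c p^(e+m)` to leading order,
      -- cancelling `s` modulo `p`.
      obtain ⟨c, hc⟩ := ZMod.natCast_zmod_surjective (-toZMod s)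
      obtain ⟨v, hv⟩ := exists_one_add_pow_eq ((p : ℤ_[p]) ^ m * p ^ e * (1 + p * y)) c
      refine ⟨k + p ^ m * c, ?_⟩
      rw [mul_one] at hy
      have h1 : (1 + (p : ℤ_[p]) ^ e) ^ (k + p ^ m * c) - u = p ^ (e + m) *
          (s + (1 + (p : ℤ_[p]) ^ e) ^ k *
            (c * (1 + p * y) + p ^ (e + m) * ((1 + p * y) ^ 2 * v))) := by
        rw [pow_add, pow_mul, hy, hv]
        linear_combination hs
      rw [h1, ← add_assoc, pow_succ _ (e + m)]
      refine mul_dvd_mul_left _ ((toZMod_eq_zero_iff _).1 ?_)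
      have he0 : e ≠ 0 := Nat.one_le_iff_ne_zero.1 he
      simp [hc, he0]
  have hc : IsClosed (Set.range (powChar p he)) :=
    (isCompact_range (continuous_powChar he)).isClosed
  suffices h : u ∈ closure (Set.range (powChar p he)) by rwa [hc.closure_eq] at h
  refine Metric.mem_closure_iff.2 fun ε hε => ?_
  obtain ⟨m, hm⟩ := PadicInt.exists_pow_neg_lt p hε
  obtain ⟨k, hk⟩ := key m
  refine ⟨_, ⟨k, rfl⟩, ?_⟩
  rw [dist_comm, dist_eq_norm]
  refine lt_of_le_of_lt ?_ hm
  rw [norm_le_pow_iff_mem_span_pow, Ideal.mem_span_singleton, powChar_natCast]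
  exact (pow_dvd_pow _ (Nat.le_add_left _ _)).trans hk

variable (p) in
/-- The homomorphism `z ↦ (1 + p ^ e) ^ z` from `ℤ_p` to the principal units. -/
def powHom : Multiplicative ℤ_[p] →* padicPrincipalUnits p :=
  (powChar p he).toMonoidHom.toHomUnits.codRestrict _ fun z => by
    ext
    change toZMod (powChar p he z.toAdd) = 1
    rw [← sub_eq_zero, ← map_one toZMod, ← map_sub, toZMod_eq_zero_iff]
    exact (dvd_pow_self _ (Nat.one_le_iff_ne_zero.1 he)).trans (pow_dvd_powChar_sub_one he _)

theorem continuous_powHom : Continuous (powHom p he) := by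
  have h1 : Continuous fun z : Multiplicative ℤ_[p] => powChar p he z.toAdd :=
    (continuous_powChar he).comp continuous_toAdd
  have h2 : Continuous fun z : Multiplicative ℤ_[p] => powChar p he (z⁻¹).toAdd :=
    h1.comp continuous_inv
  have h3 : Continuous (powChar p he).toMonoidHom.toHomUnits := by
    refine Units.continuous_iff.2 ⟨h1, h2.congr fun z => ?_⟩
    rw [← map_inv]
    rfl
  exact h3.subtype_mk _

theorem powHom_injective : Function.Injective (powHom p he) :=
  (injective_iff_map_eq_one _).2 fun _ hz =>
    powChar_eq_one he (congrArg (fun u : padicPrincipalUnits p => ((u : ℤ_[p]ˣ) : ℤ_[p])) hz)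

theorem powHom_surjective (hp : 2 < p) : Function.Surjective (powHom p le_rfl) := by
  intro u
  have hu : toZMod ((u : ℤ_[p]ˣ) : ℤ_[p]) = 1 := congrArg Units.val u.2
  obtain ⟨z, hz⟩ := exists_powChar_eq (u := ((u : ℤ_[p]ˣ) : ℤ_[p])) le_rfl (by omega) (by
    rw [pow_one, ← toZMod_eq_zero_iff, map_sub, hu, map_one, sub_self])
  exact ⟨Multiplicative.ofAdd z, Subtype.ext (Units.ext hz)⟩

/-- The homomorphism `(z, ε) ↦ 5 ^ z * ε` from `ℤ_2 × {±1}` to `ℤ_2ˣ`. -/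
def signPowHom : Multiplicative ℤ_[2] × ℤˣ →* padicPrincipalUnits 2 :=
  (powHom 2 one_le_two).coprod ((Units.map (Int.castRingHom ℤ_[2] : ℤ →* ℤ_[2])).codRestrict _
    fun _ => Subsingleton.elim _ _)

theorem coe_signPowHom (z : Multiplicative ℤ_[2]) (ε : ℤˣ) :
    ((signPowHom (z, ε) : ℤ_[2]ˣ) : ℤ_[2]) = powChar 2 one_le_two z.toAdd * ((ε : ℤ) : ℤ_[2]) :=
  rfl

theorem continuous_signPowHom : Continuous signPowHom := by
  have h : Continuous ((Units.map (Int.castRingHom ℤ_[2] : ℤ →* ℤ_[2])).codRestrict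
    (padicPrincipalUnits 2) fun _ => Subsingleton.elim _ _) := continuous_of_discreteTopology
  exact ((continuous_powHom one_le_two).comp continuous_fst).mul (h.comp continuous_snd)

theorem not_four_dvd_two : ¬ ((2 : ℕ) : ℤ_[2]) ^ 2 ∣ 2 := by
  rintro ⟨x, hx⟩
  have h1 : (2 : ℤ_[2]) * ((2 : ℕ) * x - 1) = 0 := by push_cast at *; linear_combination -hx
  rcases mul_eq_zero.1 h1 with h | h
  · exact two_ne_zero h
  · have := congrArg (toZMod (p := 2)) h
    rw [map_sub, map_mul, map_natCast, map_one, map_zero] at this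
    revert this
    generalize toZMod x = a
    revert a
    decide

/-- `5^z` is `1` modulo `4`, so it is never `-1`. -/
theorem signPowHom_injective : Function.Injective signPowHom := by
  refine (injective_iff_map_eq_one _).2 ?_
  rintro ⟨z, ε⟩ h
  have h : powChar 2 one_le_two z.toAdd * ((ε : ℤ) : ℤ_[2]) = 1 := by
    rw [← coe_signPowHom, h]; rfl
  rcases Int.units_eq_one_or ε with rfl | rfl
  · rw [Units.val_one, Int.cast_one, mul_one] at h
    exact Prod.ext (powChar_eq_one _ h) rfl
  · have h4 := pow_dvd_powChar_sub_one (p := 2) one_le_two z.toAdd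
    have : powChar 2 one_le_two z.toAdd - 1 = -2 := by
      push_cast at h
      linear_combination -h
    rw [this, dvd_neg] at h4
    exact absurd h4 not_four_dvd_two

theorem signPowHom_surjective : Function.Surjective signPowHom := by
  intro u
  set v : ℤ_[2] := ((u : ℤ_[2]ˣ) : ℤ_[2]) with hv
  have hu : toZMod v = 1 := congrArg Units.val u.2
  obtain ⟨t, ht⟩ := (toZMod_eq_zero_iff (v - 1)).1 (by rw [map_sub, hu, map_one, sub_self])
  -- A `2`-adic unit is `1` or `-1` modulo `4`, according to the parity of `t`.
  have hsign : ∃ ε : ℤˣ, ((2 : ℕ) : ℤ_[2]) ^ 2 ∣ v * ((ε : ℤ) : ℤ_[2]) - 1 := by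
    obtain h0 | h1 : toZMod t = 0 ∨ toZMod (t - 1) = 0 := by
      rw [map_sub, map_one]
      generalize toZMod t = a
      revert a
      decide
    · obtain ⟨s, rfl⟩ := (toZMod_eq_zero_iff t).1 h0
      exact ⟨1, s, by push_cast at *; linear_combination ht⟩
    · obtain ⟨s, hs⟩ := (toZMod_eq_zero_iff _).1 h1
      exact ⟨-1, -1 - s, by push_cast at *; linear_combination -ht - 2 * hs⟩
  obtain ⟨ε, hε⟩ := hsign
  obtain ⟨z, hz⟩ := exists_powChar_eq one_le_two (by norm_num) hε
  refine ⟨(Multiplicative.ofAdd z, ε), Subtype.ext (Units.ext ?_)⟩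
  rw [coe_signPowHom, toAdd_ofAdd, hz, mul_assoc, ← Int.cast_mul, ← Units.val_mul,
    Int.units_mul_self]
  simp [hv]

end PadicInt

end Padic

/-! ### Assembly of the isomorphisms -/

variable (p : ℕ) [Fact p.Prime] (n : ℕ) in
/-- The topological abelianization of the stabilizer group is the fibre product. -/
def topologicalAbelianizationEquiv [NeZero n] :
    TopologicalAbelianization (MoravaStabilizer p n) ≃ₜ* unitsFibreProduct p n :=
  quotientContinuousMulEquiv _ MoravaOrder.continuous_toFibreProduct
    MoravaOrder.toFibreProduct_surjective _ MoravaOrder.ker_toFibreProduct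

end

theorem mainTheorem11 (p : ℕ) [Fact p.Prime] (n : ℕ) (hn : 1 ≤ n) :
    Nonempty (TopologicalAbelianization (MoravaStabilizer p n) ≃ₜ* UnitsPushout p n) ∧
    Nonempty (TopologicalAbelianization (MoravaStabilizer p n) ≃ₜ* unitsFibreProduct p n) ∧
    (2 < p → Nonempty (TopologicalAbelianization (MoravaStabilizer p n) ≃ₜ*
      Multiplicative ℤ_[p] × (GaloisField p n)ˣ)) ∧
    (p = 2 → Nonempty (TopologicalAbelianization (MoravaStabilizer p n) ≃ₜ*
      Multiplicative ℤ_[p] × ℤˣ × (GaloisField p n)ˣ)) := by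
  have : NeZero n := ⟨Nat.one_le_iff_ne_zero.1 hn⟩
  let E := (topologicalAbelianizationEquiv p n).trans (unitsFibreProductEquiv p n)
  refine ⟨⟨E.trans (unitsPushoutEquiv p n).symm⟩, ⟨topologicalAbelianizationEquiv p n⟩, ?_, ?_⟩
  · intro hp
    let f := (PadicInt.powHom p le_rfl).prodMap (MonoidHom.id (GaloisField p n)ˣ)
    have hf : Continuous f := (PadicInt.continuous_powHom le_rfl).prodMap continuous_id
    have hb : Function.Bijective f := Function.Bijective.prodMap
      ⟨PadicInt.powHom_injective le_rfl, PadicInt.powHom_surjective hp⟩ Function.bijective_id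
    exact ⟨E.trans (continuousMulEquivOfBijective f hf hb).symm⟩
  · rintro rfl
    let f := (PadicInt.signPowHom.prodMap (MonoidHom.id (GaloisField 2 n)ˣ)).comp
      (MulEquiv.prodAssoc (M := Multiplicative ℤ_[2]) (N := ℤˣ)).symm.toMonoidHom
    have hf : Continuous f := (PadicInt.continuous_signPowHom.prodMap continuous_id).comp
      (Homeomorph.prodAssoc _ _ _).symm.continuous
    have hb : Function.Bijective f := (Function.Bijective.prodMap
      ⟨PadicInt.signPowHom_injective, PadicInt.signPowHom_surjective⟩ Function.bijective_id).comp
      MulEquiv.prodAssoc.symm.bijective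
    exact ⟨E.trans (continuousMulEquivOfBijective f hf hb).symm⟩
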